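/- All rings are commutative with identity, and a local ring is a ring with exactly one maximal ideal (not necessarily Noetherian). An ideal is *regular* if it contains a nonzerodivisor. A *generalized local ring* is a local ring whose maximal ideal $M$ is finitely generated and satisfies $\bigcap_{i>0} M^i = 0$. For an ideal $I$ of a ring $A$ with total quotient ring $Q(A)$, the *Nagata transform* of $I$ is the ring $T(I)=\bigcup_{k>0}\{q\in Q(A) : qI^k\subseteq A\}$. A ring is *semilocal* if it has only finitely many maximal ideals. **Theorem.** Let $R$ be a local ring. The maximal ideal of $R$ is finitely generated, regular and the radical of a principal ideal if and only if $R$ occurs (up to isomorphism) in a pullback diagram $$\begin{array}{ccc} R=\beta^{-1}(A) & \longrightarrow & A\\ \downarrow & & \downarrow{\scriptstyle\iota}\\ T & \stackrel{\beta}{\longrightarrow} & B\end{array}$$ where $A$, $B$ and $T$ are rings such that (a) $\beta:T\to B$ is a surjective ring homomorphism, $A$ is a subring of $B$ and $\iota:A\to B$ is the inclusion map; (b) $A$ is a generalized local ring whose maximal ideal is regular and is the radical of a principal ideal; (c) $B$ is (isomorphic, as an $A$-algebra, to) the Nagata transform of the maximal ideal of $A$. Moreover, in every such diagram the ring $T$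 is semilocal. -/

import Mathlib

open scoped nonZeroDivisors

universe u v w

/-- An ideal of a commutative ring is regular if it contains a nonzerodivisor. -/
def IsRegularIdeal {R : Type*} [CommRing R] (I : Ideal R) : Prop :=
  ∃ x ∈ I, x ∈ R⁰

/-- The ideal `I` is the radical of a principal ideal. -/
def IsRadicalOfPrincipal {R : Type*} [CommRing R] (I : Ideal R) : Prop :=
  ∃ m : R, I = (Ideal.span {m}).radical

/-- A generalized local ring: a (not necessarily Noetherian) local ring with maximal ideal `M`
such that `M` is finitely generated and `⋂_{i > 0} M ^ i = 0`. -/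
class IsGeneralizedLocalRing (R : Type*) [CommRing R] : Prop extends IsLocalRing R where
  fg_maximalIdeal : (IsLocalRing.maximalIdeal R).FG
  iInf_pow_eq_bot : ⨅ i : ℕ, ⨅ _ : 0 < i, IsLocalRing.maximalIdeal R ^ i = ⊥

/-- A ring is semilocal if it has only finitely many maximal ideals. -/
def IsSemilocalRing (R : Type*) [CommRing R] : Prop :=
  Finite (MaximalSpectrum R)

/-- `(R :_{Q(R)} J)`, for an ideal `J` of `R`, as a subset of the total quotient ring `Q(R)`
(which is `FractionRing R`). -/
def colonInFractionRing {R : Type*} [CommRing R] (J : Ideal R) : Set (FractionRing R) :=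
  {q | ∀ x ∈ J, q * algebraMap R (FractionRing R) x ∈ (algebraMap R (FractionRing R)).range}

theorem colonInFractionRing_anti {R : Type*} [CommRing R] {J K : Ideal R} (h : J ≤ K) :
    colonInFractionRing K ⊆ colonInFractionRing J :=
  fun _ hq x hx => hq x (h hx)

theorem mul_mem_colonInFractionRing {R : Type*} [CommRing R] {J K : Ideal R}
    {p q : FractionRing R} (hp : p ∈ colonInFractionRing J) (hq : q ∈ colonInFractionRing K) :
    p * q ∈ colonInFractionRing (J * K) := by
  intro x hx
  induction hx using Submodule.mul_induction_on' with
  | mem_mul_mem a ha b hb =>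
    have h := mul_mem (hp a ha) (hq b hb)
    rw [map_mul]
    convert h using 1
    ring
  | add a _ b _ ha hb =>
    rw [map_add, mul_add]
    exact add_mem ha hb

/-- The Nagata transform `T(I) = ⋃_{k > 0} (R :_{Q(R)} I ^ k)` of an ideal `I` of `R`, an
`R`-subalgebra of the total quotient ring `Q(R)`. -/
def nagataTransform {R : Type*} [CommRing R] (I : Ideal R) : Subalgebra R (FractionRing R) where
  carrier := ⋃ k : ℕ, ⋃ _ : 0 < k, colonInFractionRing (I ^ k)
  mul_mem' := by
    intro p q hp hq
    simp only [Set.mem_iUnion, exists_prop] at hp hq ⊢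
    obtain ⟨k, hk, hp⟩ := hp
    obtain ⟨l, hl, hq⟩ := hq
    exact ⟨k + l, by omega, by rw [pow_add]; exact mul_mem_colonInFractionRing hp hq⟩
  add_mem' := by
    intro p q hp hq
    simp only [Set.mem_iUnion, exists_prop] at hp hq ⊢
    obtain ⟨k, hk, hp⟩ := hp
    obtain ⟨l, hl, hq⟩ := hq
    refine ⟨k + l, by omega, fun x hx => ?_⟩
    rw [add_mul]
    exact add_mem (colonInFractionRing_anti (Ideal.pow_le_pow_right (by omega)) hp x hx)
      (colonInFractionRing_anti (Ideal.pow_le_pow_right (by omega)) hq x hx)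
  algebraMap_mem' := by
    intro r
    simp only [Set.mem_iUnion, exists_prop]
    exact ⟨1, one_pos, fun x _ => ⟨r * x, map_mul _ _ _⟩⟩

/-- `R` occurs in the pullback diagram `R = β⁻¹(A)` of the surjection `β : T → B` along the
inclusion of the subring `A ⊆ B`, where `A` is a generalized local ring with regular maximal ideal
that is the radical of a principal ideal, and `B` is (as an extension ring of `A`) the Nagata
transform of the maximal ideal of `A`. The map `j : R → T` is the left-hand arrow of the diagram;
it identifies `R` with `β⁻¹(A)`. -/
structure IsGLRPullback {R T B : Type*} [CommRing R] [CommRing T] [CommRing B]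
    (j : R →+* T) (β : T →+* B) (A : Subring B) : Prop where
  injective_left : Function.Injective j
  range_left : j.range = A.comap β
  surjective : Function.Surjective β
  generalizedLocal : IsGeneralizedLocalRing A
  regular : IsRegularIdeal (IsLocalRing.maximalIdeal A)
  radical : IsRadicalOfPrincipal (IsLocalRing.maximalIdeal A)
  nagata : Nonempty (B ≃ₐ[A] nagataTransform (IsLocalRing.maximalIdeal A))

/-! The diagram is localization at one element. If a finitely generated ideal `I` is the radical of
`(a)`, then some `I ^ k ≤ (a)`; for regular `a`, allowing denominators killed by powers of `I`
therefore means inverting `a`, and `B = A[1/a]`.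

Given `R` with maximal ideal `√(m)`, the ideal `P = ⋂ (m ^ i)` equals `⋂ M ^ i`, and `m` acts
bijectively on it, so `P` is also an ideal of `T = R[1/m]`. Take `A = R/P` and `B = T/P`.

Conversely, a lift `m` of `a` to `R` becomes a unit in `T`, and the kernel of `R → A` is an ideal of
`T`, hence lies in `(m)`. Finite generation and the radical condition then lift from `A` to `R`, and
`T = R[1/m]`.

`T` is semilocal because `R/(m)` is Artinian: contracted intersections of infinitely many maximal
ideals of `T` would stabilize modulo `m`, which a Nakayama-type argument forbids. -/

/-! ### Nagata transforms as localizations -/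

namespace IsLocalization

/-- An injective `R`-algebra `S` in which `a` is invertible and in which every element has a
denominator that is a power of `a` is the localization of `R` away from `a`. -/
theorem away_of_injective {R S : Type*} [CommRing R] [CommRing S] [Algebra R S] {a : R}
    (hinj : Function.Injective (algebraMap R S)) (hu : IsUnit (algebraMap R S a))
    (hsurj : ∀ z : S, ∃ (k : ℕ) (r : R), z * algebraMap R S a ^ k = algebraMap R S r) :
    IsLocalization.Away a S := by
  refine (isLocalization_iff (Submonoid.powers a) S).mpr ⟨?_, ?_, ?_⟩
  · rintro ⟨_, k, rfl⟩
    simpa using hu.pow k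
  · intro z
    obtain ⟨k, r, h⟩ := hsurj z
    exact ⟨(r, ⟨a ^ k, k, rfl⟩), by simpa using h⟩
  · intro x y h
    exact ⟨1, by rw [hinj h]⟩

end IsLocalization

/-- If a regular ideal is contained in the radical of `(a)`, then `a` is a nonzerodivisor. -/
theorem IsRegularIdeal.mem_nonZeroDivisors {R : Type*} [CommRing R] {I : Ideal R}
    (hI : IsRegularIdeal I) {a : R} (h : I ≤ (Ideal.span {a}).radical) : a ∈ R⁰ := by
  obtain ⟨x, hxI, hx⟩ := hI
  obtain ⟨n, hn⟩ := h hxI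
  obtain ⟨c, hc⟩ := Ideal.mem_span_singleton'.mp hn
  have hm : c * a ∈ R⁰ := hc ▸ pow_mem hx n
  exact (mul_mem_nonZeroDivisors.mp hm).2

/-- The Nagata transform of a finitely generated ideal `I` which is the radical of `(a)`, with `a`
a nonzerodivisor, is the localization away from `a`. -/
theorem nagataTransform_isLocalizationAway {R : Type*} [CommRing R] {I : Ideal R} {a : R}
    (hfg : I.FG) (hI : I = (Ideal.span {a}).radical) (ha : a ∈ R⁰) :
    IsLocalization.Away a (nagataTransform I) := by
  have haI : a ∈ I := hI ▸ Ideal.le_radical (Ideal.mem_span_singleton_self a)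
  obtain ⟨k, hk⟩ := Ideal.exists_pow_le_of_le_radical_of_fg hI.le hfg
  have hinj : Function.Injective (algebraMap R (FractionRing R)) :=
    IsLocalization.injective _ le_rfl
  have hau : IsUnit (algebraMap R (FractionRing R) a) :=
    IsLocalization.map_units (M := R⁰) (FractionRing R) ⟨a, ha⟩
  refine IsLocalization.away_of_injective ?_ ?_ ?_
  · intro x y h
    exact hinj (congrArg Subtype.val h)
  · obtain ⟨b, hb⟩ := hau.exists_right_inv
    have hbm : b ∈ nagataTransform I := by
      -- `k` may be `0`, but the union runs over positive exponents; hence `k + 1`.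
      refine Set.mem_iUnion₂.mpr ⟨k + 1, k.succ_pos, fun x hx => ?_⟩
      obtain ⟨c, rfl⟩ := Ideal.mem_span_singleton'.mp
        (hk (Ideal.pow_le_pow_right k.le_succ hx))
      exact ⟨c, by rw [map_mul, mul_left_comm, mul_comm b, hb, mul_one]⟩
    exact .of_mul_eq_one (⟨b, hbm⟩ : nagataTransform I) (Subtype.ext hb)
  · rintro ⟨z, hz⟩
    obtain ⟨n, -, hn⟩ := Set.mem_iUnion₂.mp hz
    obtain ⟨r, hr⟩ := hn (a ^ n) (Ideal.pow_mem_pow haI n)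
    refine ⟨n, r, Subtype.ext ?_⟩
    rw [map_pow] at hr
    exact hr.symm

/-! ### Semilocality of `T` -/

/-- If the maximal ideal of a local ring is finitely generated and the radical of `(m)`, then the
quotient by `(m)` is Artinian. -/
theorem IsLocalRing.isArtinianRing_quotient_span_singleton {R : Type*} [CommRing R]
    [IsLocalRing R] {m : R} (hfg : (IsLocalRing.maximalIdeal R).FG)
    (hm : IsLocalRing.maximalIdeal R = (Ideal.span {m}).radical) :
    IsArtinianRing (R ⧸ Ideal.span {m}) := by
  set q := Ideal.Quotient.mk (Ideal.span {m})
  have hq : Function.Surjective q := Ideal.Quotient.mk_surjective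
  have hprime : ∀ I : Ideal (R ⧸ Ideal.span {m}), I.IsPrime →
      I.comap q = IsLocalRing.maximalIdeal R := by
    intro I hI
    have hc : (I.comap q).IsPrime := Ideal.comap_isPrime q I
    refine le_antisymm (IsLocalRing.le_maximalIdeal hc.ne_top) ?_
    rw [hm, hc.radical_le_iff, Ideal.span_singleton_le_iff_mem, Ideal.mem_comap,
      Ideal.Quotient.eq_zero_iff_mem.mpr (Ideal.mem_span_singleton_self m)]
    exact I.zero_mem
  -- The only prime is the image of the maximal ideal, which is finitely generated; Cohen's theorem
  -- gives Noetherian.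
  refine isArtinianRing_iff_isNoetherianRing_krullDimLE_zero.mpr
    ⟨IsNoetherianRing.of_prime fun I hI => ?_, Ring.krullDimLE_zero_iff.mpr fun I hI => ?_⟩
  · rw [← Ideal.map_comap_of_surjective q hq I, hprime I hI]
    exact hfg.map q
  · have hmax : (I.comap q).IsMaximal := hprime I hI ▸ IsLocalRing.maximalIdeal.isMaximal R
    have := Ideal.map_eq_top_or_isMaximal_of_surjective q hq hmax
    rw [Ideal.map_comap_of_surjective q hq] at this
    exact this.resolve_left hI.ne_top

/-- Inverting an element `m` of a local ring whose maximal ideal is finitely generated and the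
radical of `(m)` gives a semilocal ring. -/
theorem isSemilocalRing_of_away {R T : Type*} [CommRing R] [IsLocalRing R] [CommRing T]
    (j : R →+* T) {m : R} (hfg : (IsLocalRing.maximalIdeal R).FG)
    (hm : IsLocalRing.maximalIdeal R = (Ideal.span {m}).radical) (hu : IsUnit (j m))
    (hden : ∀ t : T, ∃ (k : ℕ) (r : R), t * j m ^ k = j r) : IsSemilocalRing T := by
  by_contra hinf
  rw [IsSemilocalRing, not_finite_iff_infinite] at hinf
  have hart := IsLocalRing.isArtinianRing_quotient_span_singleton hfg hm
  have hmM : m ∈ IsLocalRing.maximalIdeal R :=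
    hm ▸ Ideal.le_radical (Ideal.mem_span_singleton_self m)
  let e := Infinite.natEmbedding (MaximalSpectrum T)
  let Q : ℕ → Ideal T := fun i => (e i).asIdeal
  have hQ : ∀ i, (Q i).IsMaximal := fun i => (e i).isMaximal
  let J : ℕ → Ideal R := fun n => (⨅ i ∈ Finset.range n, Q i).comap j
  have hJ : ∀ n x, x ∈ J n ↔ ∀ i < n, j x ∈ Q i := by
    intro n x
    simp [J, Ideal.mem_comap, Submodule.mem_iInf]
  have hJanti : Antitone J := fun a b hab x hx =>
    (hJ a x).mpr fun i hi => (hJ b x).mp hx i (hi.trans_le hab)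
  obtain ⟨n, hn⟩ := IsArtinian.monotone_stabilizes
    (⟨fun n => OrderDual.toDual ((J n).map (Ideal.Quotient.mk (Ideal.span {m}))),
      fun a b hab => Ideal.map_mono (hJanti hab)⟩ :
      ℕ →o (Ideal (R ⧸ Ideal.span {m}))ᵒᵈ)
  have hstab : (J n).map (Ideal.Quotient.mk (Ideal.span {m})) =
      (J (n + 1)).map (Ideal.Quotient.mk (Ideal.span {m})) := hn (n + 1) n.le_succ
  -- `J n ⊆ J (n + 1) + m J n`
  have step : ∀ x ∈ J n, ∃ y ∈ J (n + 1), ∃ b ∈ J n, x = y + m * b := by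
    intro x hx
    obtain ⟨y, hy, hxy⟩ := (Ideal.mem_map_iff_of_surjective _ Ideal.Quotient.mk_surjective).mp
      (hstab ▸ Ideal.mem_map_of_mem _ hx)
    obtain ⟨b, hb⟩ := Ideal.mem_span_singleton'.mp (Ideal.Quotient.eq.mp hxy.symm)
    refine ⟨y, hy, b, (hJ n b).mpr fun i hi => ?_, by linear_combination -hb⟩
    have hmb : j (b * m) ∈ Q i := by
      rw [hb]
      exact (hJ n _).mp (sub_mem hx (hJanti n.le_succ hy)) i hi
    rw [map_mul] at hmb
    exact (Ideal.mul_unit_mem_iff_mem _ hu).mp hmb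
  have iter : ∀ k : ℕ, ∀ x ∈ J n, ∃ y ∈ J (n + 1), ∃ b ∈ J n, x = y + m ^ k * b := by
    intro k
    induction k with
    | zero => exact fun x hx => ⟨0, zero_mem _, x, hx, by simp⟩
    | succ k ih =>
      intro x hx
      obtain ⟨y, hy, b, hb, rfl⟩ := ih x hx
      obtain ⟨y', hy', b', hb', rfl⟩ := step b hb
      exact ⟨y + m ^ k * y', add_mem hy (Ideal.mul_mem_left _ _ hy'), b', hb', by ring⟩
  have hcop : IsCoprime (Q n) (⨅ i ∈ Finset.range n, Q i) := by
    refine Ideal.isCoprime_biInf fun i hi => ?_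
    have hne : Q n ≠ Q i := fun h =>
      (Finset.mem_range.mp hi).ne' (e.injective (MaximalSpectrum.ext h))
    exact Ideal.isCoprime_of_isMaximal hne
  obtain ⟨u, hun, x, hx, hux⟩ := Ideal.isCoprime_iff_exists.mp hcop
  obtain ⟨s, r, hr⟩ := hden x
  have hrJ : r ∈ J n := by
    rw [Ideal.mem_comap, ← hr]
    exact Ideal.mul_mem_right _ _ hx
  -- One power more than the denominator `m ^ s` of `x`: cancelling `m ^ s` leaves `1 - m * b`, a
  -- unit of `R`, in `Q n`.
  obtain ⟨y, hy, b, -, hyb⟩ := iter (s + 1) r hrJ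
  have hyQ : j y ∈ Q n := (hJ _ y).mp hy n n.lt_succ_self
  have hmem : j (1 - m * b) * j m ^ s ∈ Q n := by
    have hj : j r = j y + j m ^ (s + 1) * j b := by rw [hyb]; simp
    have : j (1 - m * b) * j m ^ s = u * j m ^ s + j y := by
      rw [map_sub, map_one, map_mul]
      linear_combination hr + hj - j m ^ s * hux
    rw [this]
    exact add_mem (Ideal.mul_mem_right _ _ hun) hyQ
  have hunit : IsUnit (1 - m * b) := by
    by_contra h
    refine (IsLocalRing.maximalIdeal.isMaximal R).ne_top ((Ideal.eq_top_iff_one _).mpr ?_)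
    have := add_mem ((IsLocalRing.mem_maximalIdeal _).mpr h) (Ideal.mul_mem_right b _ hmM)
    rwa [sub_add_cancel] at this
  exact (hQ n).ne_top (Ideal.eq_top_of_isUnit_mem _ hmem ((hunit.map j).mul (hu.pow s)))

/-! ### From the diagram back to `R` -/

/-- In a pullback diagram of the given kind, `T` is obtained from `R` by inverting an element `m`
such that the maximal ideal of `R` is the radical of `(m)`. -/
theorem IsGLRPullback.exists_isUnit {R T B : Type*} [CommRing R] [IsLocalRing R] [CommRing T]
    [CommRing B] {j : R →+* T} {β : T →+* B} {A : Subring B} (h : IsGLRPullback j β A) :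
    ∃ m : R, (IsLocalRing.maximalIdeal R).FG ∧
      IsLocalRing.maximalIdeal R = (Ideal.span {m}).radical ∧ IsUnit (j m) ∧
      ∀ t : T, ∃ (k : ℕ) (r : R), t * j m ^ k = j r := by
  have := h.generalizedLocal
  obtain ⟨a, ha⟩ := h.radical
  obtain ⟨φ⟩ := h.nagata
  have haA := h.regular.mem_nonZeroDivisors ha.le
  have hloc := nagataTransform_isLocalizationAway
    IsGeneralizedLocalRing.fg_maximalIdeal ha haA
  have hB : IsLocalization.Away a B :=
    IsLocalization.isLocalization_of_algEquiv (Submonoid.powers a) φ.symm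
  have hmem : ∀ r, β (j r) ∈ A := fun r => by
    have : j r ∈ A.comap β := h.range_left ▸ ⟨r, rfl⟩
    exact this
  have hlift : ∀ t, β t ∈ A → ∃ r, j r = t := fun t ht => by
    have : t ∈ j.range := h.range_left ▸ ht
    exact this
  let f : R →+* A := (β.comp j).codRestrict A hmem
  have hf : Function.Surjective f := by
    rintro ⟨b, hb⟩
    obtain ⟨t, rfl⟩ := h.surjective b
    obtain ⟨r, rfl⟩ := hlift t hb
    exact ⟨r, rfl⟩
  have hcomap : (IsLocalRing.maximalIdeal A).comap f = IsLocalRing.maximalIdeal R :=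
    IsLocalRing.eq_maximalIdeal (Ideal.comap_isMaximal_of_surjective f hf)
  obtain ⟨m, hm⟩ := hf a
  have hmA : β (j m) = a := congrArg Subtype.val hm
  have hmM : m ∈ IsLocalRing.maximalIdeal R := by
    rw [← hcomap, Ideal.mem_comap, hm, ha]
    exact Ideal.le_radical (Ideal.mem_span_singleton_self a)
  have haB : IsUnit (a : B) := IsLocalization.Away.algebraMap_isUnit (S := B) a
  have hu : IsUnit (j m) := by
    obtain ⟨b, hb⟩ := haB.exists_right_inv
    obtain ⟨t, rfl⟩ := h.surjective b
    -- The product is `1` only modulo `ker β`, but it comes from an `r` in `R` lying outside the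
    -- maximal ideal.
    obtain ⟨r, hr⟩ := hlift (j m * t) (by rw [map_mul, hmA, hb]; exact A.one_mem)
    have hfr : f r = 1 := Subtype.ext (by
      change β (j r) = 1
      rw [hr, map_mul, hmA, hb])
    have hru : IsUnit r := by
      by_contra hn
      have hrM : r ∈ (IsLocalRing.maximalIdeal A).comap f :=
        hcomap ▸ (IsLocalRing.mem_maximalIdeal r).mpr hn
      rw [Ideal.mem_comap, hfr] at hrM
      exact (IsLocalRing.maximalIdeal.isMaximal A).ne_top ((Ideal.eq_top_iff_one _).mpr hrM)
    exact isUnit_of_mul_isUnit_left (hr ▸ hru.map j)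
  -- `ker β` is stable under the inverse of `j m` and lies in the image of `R`.
  have hker : RingHom.ker f ≤ Ideal.span {m} := by
    intro x hx
    have hx0 : β (j x) = 0 := congrArg Subtype.val (RingHom.mem_ker.mp hx)
    obtain ⟨t, ht⟩ := hu.exists_right_inv
    obtain ⟨y, hy⟩ := hlift (t * j x) (by rw [map_mul, hx0, mul_zero]; exact A.zero_mem)
    refine Ideal.mem_span_singleton'.mpr ⟨y, h.injective_left ?_⟩
    rw [map_mul, hy]
    linear_combination j x * ht
  refine ⟨m, ?_, ?_, hu, fun t => ?_⟩
  · obtain ⟨s, hs⟩ := (IsGeneralizedLocalRing.fg_maximalIdeal (R := A))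
    choose g hg using hf
    classical
    have key : IsLocalRing.maximalIdeal R = Ideal.span (s.image g : Set R) ⊔ Ideal.span {m} := by
      apply le_antisymm
      · have hmap : (Ideal.span (s.image g : Set R)).map f = IsLocalRing.maximalIdeal A := by
          rw [Ideal.map_span, ← hs]
          rw [Finset.coe_image, ← Set.image_comp, show ⇑f ∘ g = id from funext hg,
            Set.image_id]
        rw [← hcomap, ← hmap, Ideal.comap_map_of_surjective' f (fun x => ⟨g x, hg x⟩)]
        exact sup_le_sup_left hker _
      · refine sup_le (Ideal.span_le.mpr ?_) ((Ideal.span_singleton_le_iff_mem _).mpr hmM)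
        intro x hx
        obtain ⟨y, hy, rfl⟩ := Finset.mem_image.mp (Finset.mem_coe.mp hx)
        rw [SetLike.mem_coe, ← hcomap, Ideal.mem_comap, hg, ← hs]
        exact Submodule.subset_span hy
    rw [key]
    exact Submodule.FG.sup ⟨_, rfl⟩ (Submodule.fg_span_singleton m)
  · apply le_antisymm
    · intro x hx
      rw [← hcomap, Ideal.mem_comap, ha] at hx
      obtain ⟨n, hn⟩ := hx
      obtain ⟨c, hc⟩ := Ideal.mem_span_singleton'.mp hn
      obtain ⟨d, rfl⟩ := hf c
      refine ⟨n, ?_⟩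
      have hd : x ^ n - d * m ∈ Ideal.span {m} :=
        hker (by rw [RingHom.mem_ker, map_sub, map_mul, map_pow, hm, hc, sub_self])
      simpa using add_mem hd (Ideal.mul_mem_left _ d (Ideal.mem_span_singleton_self m))
    · rw [(IsLocalRing.maximalIdeal.isMaximal R).isPrime.radical_le_iff,
        Ideal.span_singleton_le_iff_mem]
      exact hmM
  · obtain ⟨k, c, hc⟩ := IsLocalization.Away.surj a (β t)
    obtain ⟨r, hr⟩ := hlift (t * j m ^ k) (by
      rw [map_mul, map_pow, hmA]
      exact hc ▸ c.2)
    exact ⟨k, r, hr.symm⟩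

/-! ### Construction of the diagram -/

/-- A local ring whose maximal ideal is finitely generated, regular and the radical of a principal
ideal `(m)` occurs in a pullback diagram in which `T` is the localization of `R` away from `m`. -/
theorem exists_isGLRPullback {R : Type u} [CommRing R] [IsLocalRing R]
    (hfg : (IsLocalRing.maximalIdeal R).FG) (hreg : IsRegularIdeal (IsLocalRing.maximalIdeal R))
    (hrad : IsRadicalOfPrincipal (IsLocalRing.maximalIdeal R)) :
    ∃ (T B : Type u) (_ : CommRing T) (_ : CommRing B)
      (j : R →+* T) (β : T →+* B) (A : Subring B), IsGLRPullback j β A := by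
  obtain ⟨m, hm⟩ := hrad
  have hm0 : m ∈ R⁰ := hreg.mem_nonZeroDivisors hm.le
  have hmM : m ∈ IsLocalRing.maximalIdeal R :=
    hm ▸ Ideal.le_radical (Ideal.mem_span_singleton_self m)
  let T := Localization.Away m
  let j : R →+* T := algebraMap R T
  have hj : Function.Injective j :=
    IsLocalization.injective T (M := Submonoid.powers m) (Submonoid.powers_le.mpr hm0)
  have hu : IsUnit (j m) := IsLocalization.Away.algebraMap_isUnit (S := T) m
  -- the ideal `P = ⋂ (m ^ i)` of `R`, on which `m` acts bijectively
  let P : Ideal R := ⨅ i : ℕ, Ideal.span {m ^ i}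
  have hP : ∀ x, x ∈ P ↔ ∀ i : ℕ, m ^ i ∣ x := by
    intro x
    simp [P, Submodule.mem_iInf, Ideal.mem_span_singleton]
  have hmul : ∀ (k : ℕ) (x : R), m ^ k * x ∈ P ↔ x ∈ P := by
    refine fun k x => ⟨fun h => (hP x).mpr fun i => ?_, fun h => Ideal.mul_mem_left _ _ h⟩
    have := (hP _).mp h (k + i)
    rw [pow_add] at this
    obtain ⟨c, hc⟩ := this
    refine ⟨c, ?_⟩
    have hk : m ^ k ∈ R⁰ := pow_mem hm0 k
    rw [mul_assoc] at hc
    exact (mul_cancel_left_mem_nonZeroDivisors hk).mp hc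
  have hPT : ∀ t : T, t ∈ P.map j ↔ ∃ p ∈ P, j p = t := by
    refine fun t => ⟨fun ht => ?_, fun ⟨p, hp, h⟩ => h ▸ Ideal.mem_map_of_mem j hp⟩
    obtain ⟨⟨⟨p, hp⟩, ⟨_, k, rfl⟩⟩, h⟩ :=
      (IsLocalization.mem_map_algebraMap_iff (Submonoid.powers m) T).mp ht
    obtain ⟨q, rfl⟩ := (hP p).mp hp k
    -- Dividing by `m ^ k` stays inside `P`, so the extension of `P` to `T` is just `j(P)`.
    refine ⟨q, (hmul k q).mp hp, (hu.pow k).mul_left_cancel ?_⟩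
    have h' : t * j (m ^ k) = j (m ^ k * q) := h
    rw [map_mul, map_pow] at h'
    rw [← h', mul_comm]
  let β : T →+* T ⧸ P.map j := Ideal.Quotient.mk _
  let A : Subring (T ⧸ P.map j) := (β.comp j).range
  let f : R →+* A := (β.comp j).rangeRestrict
  have hf : Function.Surjective f := (β.comp j).rangeRestrict_surjective
  have hker : ∀ x, f x = 0 ↔ x ∈ P := by
    intro x
    rw [Subtype.ext_iff]
    change β (j x) = 0 ↔ _
    rw [Ideal.Quotient.eq_zero_iff_mem, hPT]
    exact ⟨fun ⟨p, hp, h⟩ => hj h ▸ hp, fun hx => ⟨x, hx, rfl⟩⟩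
  have hPM : ∀ i : ℕ, P ≤ IsLocalRing.maximalIdeal R ^ i := fun i x hx =>
    Ideal.mem_of_dvd _ ((hP x).mp hx i) (Ideal.pow_mem_pow hmM i)
  have hnt : Nontrivial A := by
    refine ⟨f 1, 0, fun h => ?_⟩
    have h1 := hPM 1 ((hker 1).mp h)
    rw [pow_one] at h1
    exact (IsLocalRing.maximalIdeal.isMaximal R).ne_top ((Ideal.eq_top_iff_one _).mpr h1)
  have hlocal : IsLocalRing A := IsLocalRing.of_surjective' f hf
  have hmap : (IsLocalRing.maximalIdeal R).map f = IsLocalRing.maximalIdeal A :=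
    IsLocalRing.map_maximalIdeal_of_surjective f hf
  have hcomap : (IsLocalRing.maximalIdeal A).comap f = IsLocalRing.maximalIdeal R :=
    IsLocalRing.eq_maximalIdeal (Ideal.comap_isMaximal_of_surjective f hf)
  have hAfg : (IsLocalRing.maximalIdeal A).FG := hmap ▸ hfg.map f
  have hAm : f m ∈ IsLocalRing.maximalIdeal A := hmap ▸ Ideal.mem_map_of_mem f hmM
  have hA0 : f m ∈ A⁰ := by
    rw [mem_nonZeroDivisors_iff_right]
    intro z hz
    obtain ⟨x, rfl⟩ := hf z
    rw [← map_mul, hker, mul_comm] at hz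
    exact (hker x).mpr ((hmul 1 x).mp (by rwa [pow_one]))
  have hArad : IsLocalRing.maximalIdeal A = (Ideal.span {f m}).radical := by
    apply le_antisymm
    · intro z hz
      obtain ⟨x, rfl⟩ := hf z
      have hx : x ∈ (IsLocalRing.maximalIdeal A).comap f := hz
      rw [hcomap, hm] at hx
      obtain ⟨n, hn⟩ := hx
      refine ⟨n, ?_⟩
      rw [← map_pow, ← Set.image_singleton, ← Ideal.map_span]
      exact Ideal.mem_map_of_mem f hn
    · rw [(IsLocalRing.maximalIdeal.isMaximal A).isPrime.radical_le_iff,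
        Ideal.span_singleton_le_iff_mem]
      exact hAm
  obtain ⟨k, hk⟩ := Ideal.exists_pow_le_of_le_radical_of_fg hm.le hfg
  have hMP : ∀ x, (∀ i : ℕ, 0 < i → f x ∈ IsLocalRing.maximalIdeal A ^ i) → x ∈ P := by
    refine fun x hx => (hP x).mpr fun i => ?_
    -- `M ^ (k * i) ≤ (m ^ i)`; the extra `1` keeps the exponent positive when `k * i = 0`.
    have h1 := hx (k * i + 1) (Nat.succ_pos _)
    rw [← hmap, ← Ideal.map_pow] at h1
    obtain ⟨y, hy, hyx⟩ := (Ideal.mem_map_iff_of_surjective f hf).mp h1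
    have hy' : m ^ i ∣ y := by
      have h2 := Ideal.pow_right_mono hk i
        (pow_mul (IsLocalRing.maximalIdeal R) k i ▸ Ideal.pow_le_pow_right (Nat.le_succ _) hy)
      rwa [Ideal.span_singleton_pow, Ideal.mem_span_singleton] at h2
    have hsub : x - y ∈ P := (hker _).mp (by rw [map_sub, hyx, sub_self])
    simpa using dvd_add ((hP _).mp hsub i) hy'
  have hB : IsLocalization.Away (f m) (T ⧸ P.map j) := by
    refine IsLocalization.away_of_injective Subtype.val_injective (hu.map β) fun z => ?_
    obtain ⟨t, rfl⟩ := Ideal.Quotient.mk_surjective z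
    obtain ⟨n, r, hr⟩ := IsLocalization.Away.surj m t
    refine ⟨n, f r, ?_⟩
    change β t * β (j m) ^ n = β (j r)
    rw [← map_pow, ← map_mul]
    exact congrArg β hr
  have hN := nagataTransform_isLocalizationAway hAfg hArad hA0
  refine ⟨T, T ⧸ P.map j, inferInstance, inferInstance, j, β, A, ?_⟩
  exact
    { injective_left := hj
      range_left := by
        ext t
        constructor
        · rintro ⟨r, rfl⟩
          exact ⟨r, rfl⟩
        · rintro ⟨r, hr⟩
          obtain ⟨p, -, hp⟩ := (hPT _).mp (Ideal.Quotient.eq.mp hr.symm)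
          exact ⟨p + r, by rw [map_add, hp, sub_add_cancel]⟩
      surjective := Ideal.Quotient.mk_surjective
      generalizedLocal :=
        { hlocal with
          fg_maximalIdeal := hAfg
          iInf_pow_eq_bot := by
            rw [eq_bot_iff]
            intro z hz
            obtain ⟨x, rfl⟩ := hf z
            simp only [Submodule.mem_iInf] at hz
            exact (hker x).mpr (hMP x hz) }
      regular := ⟨f m, hAm, hA0⟩
      radical := ⟨f m, hArad⟩
      nagata := ⟨IsLocalization.algEquiv (Submonoid.powers (f m)) _ _⟩ }

theorem mainTheorem4 (R : Type u) [CommRing R] [IsLocalRing R] :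
    (((IsLocalRing.maximalIdeal R).FG ∧
        IsRegularIdeal (IsLocalRing.maximalIdeal R) ∧
        IsRadicalOfPrincipal (IsLocalRing.maximalIdeal R)) ↔
      ∃ (T B : Type u) (_ : CommRing T) (_ : CommRing B)
        (j : R →+* T) (β : T →+* B) (A : Subring B), IsGLRPullback j β A) ∧
    (∀ (T : Type v) (B : Type w) [CommRing T] [CommRing B]
        (j : R →+* T) (β : T →+* B) (A : Subring B),
        IsGLRPullback j β A → IsSemilocalRing T) := by
  refine ⟨⟨fun ⟨hfg, hreg, hrad⟩ => exists_isGLRPullback hfg hreg hrad, ?_⟩, ?_⟩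
  · rintro ⟨T, B, _, _, j, β, A, h⟩
    obtain ⟨m, hfg, hm, hu, -⟩ := h.exists_isUnit
    refine ⟨hfg, ⟨m, hm ▸ Ideal.le_radical (Ideal.mem_span_singleton_self m), ?_⟩, m, hm⟩
    rw [mem_nonZeroDivisors_iff_right]
    intro x hx
    refine h.injective_left ?_
    rw [map_zero, ← hu.mul_left_eq_zero, ← map_mul, hx, map_zero]
  · intro T B _ _ j β A h
    obtain ⟨m, hfg, hm, hu, hden⟩ := h.exists_isUnit
    exact isSemilocalRing_of_away j hfg hm hu hden
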